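/- **Data.** Let $\mathcal X=\{\mathbf x=(\mathbf x_c,\mathbf x_d)\in\mathbb R^{n_x}_+\times\mathbb Z^{m_x}_+:\ \mathbf A\mathbf x\ge\mathbf b\}$, let $\mathbb U_d\subseteq\mathbb Z^{m_u}_+$ be finite, let $\mathbf F_c,\mathbf F_d$ be arbitrary matrix-valued functions of $\mathbf x$, and put $$\mathcal U(\mathbf x)=\{(\mathbf u_c,\mathbf u_d)\in\mathbb R^{n_u}_+\times\mathbb U_d:\ \mathbf F_c(\mathbf x)\mathbf u_c+\mathbf F_d(\mathbf x)\mathbf u_d\le\mathbf h+\mathbf G\mathbf x\},$$ $$\mathcal Y(\mathbf x,\mathbf u)=\{\mathbf y\in\mathbb R^{n_y}_+:\ \mathbf B_2\mathbf y\ge\mathbf d-\mathbf B_1\mathbf x-\mathbf E_c\mathbf u_c-\mathbf E_d\mathbf u_d\}.$$ The two-stage robust program with mixed-integer decision-dependent uncertainty and LP recourse is $$\mathbf{2\text{-}Stg\ RO}:\quad w^*=\min_{\mathbf x\in\mathcal X}\ \mathbf c_1\mathbf x+\max_{\mathbf u\in\mathcal U(\mathbf x)}\ \min_{\mathbf y\in\mathcal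 Y(\mathbf x,\mathbf u)}\mathbf c_2\mathbf y .$$ Here $\mathbf x\in\mathcal X$ is feasible if $\mathcal Y(\mathbf x,\mathbf u)\ne\emptyset$ for all $\mathbf u\in\mathcal U(\mathbf x)$, and an infeasible program has value $+\infty$. Optimal values are infima in $[-\infty,+\infty]$; an optimal solution is a feasible point attaining the optimal value. **Assumptions.** (A1) $\mathcal U(\mathbf x)\neq\emptyset$ for all $\mathbf x\in\mathcal X$. (A2) $\mathcal U(\mathbf x)$ is bounded for all $\mathbf x\in\mathcal X$. (A3) $\mathbf c_1\mathbf x+\mathbf c_2\mathbf y$ is bounded below over all $\mathbf x\in\mathcal X$, $\mathbf u\in\mathcal U(\mathbf x)$, $\mathbf y\in\mathcal Y(\mathbf x,\mathbf u)$. **Notation.** Let $\Pi=\{\pi\ge\mathbf 0:\ \mathbf B_2^\intercal\pi\le\mathbf c_2^\intercal\}$, let $\mathcal P_\Pi$ be the set of its extreme points, and let $\mathcal R_\Pi$ contain exactly one generating vector (of any scaling) of each extreme ray of the recession cone $\{\gamma\ge\mathbf 0:\ \mathbf B_2^\intercal\gamma\le\mathbf 0\}$. For $M\in\mathbb R$,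 $\mathbf x\in\mathcal X$, $\mathbf u_d\in\mathbb U_d$ and a vector $\boldsymbol\beta$, let $\mathcal O_M(\mathbf x,\mathbf u_d,\boldsymbol\beta)$ be the set of all $(\mathbf u_c,\tilde{\mathbf u},\lambda)\ge\mathbf 0$ that satisfy the KKT system $$\mathbf F_c(\mathbf x)\mathbf u_c-\tilde{\mathbf u}\le \mathbf r,\qquad \mathbf F_c(\mathbf x)^\intercal\lambda\ge-\mathbf E_c^\intercal\boldsymbol\beta,\qquad \lambda\le M\mathbf 1,$$ $$\lambda\circ(\mathbf r-\mathbf F_c(\mathbf x)\mathbf u_c+\tilde{\mathbf u})=\mathbf 0,\qquad \mathbf u_c\circ(\mathbf F_c(\mathbf x)^\intercal\lambda+\mathbf E_c^\intercal\boldsymbol\beta)=\mathbf 0,\qquad \tilde{\mathbf u}\circ(M\mathbf 1-\lambda)=\mathbf 0,$$ where $\mathbf r=\mathbf h+\mathbf G\mathbf x-\mathbf F_d(\mathbf x)\mathbf u_d$, of the linear program $$\mathbf{LP}(\mathbf x,\mathbf u_d,\boldsymbol\beta):\quad \max\{(-\mathbf E_c\mathbf u_c)^\intercal\boldsymbol\beta-M\,\mathbf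 1^\intercal\tilde{\mathbf u}:\ \mathbf F_c(\mathbf x)\mathbf u_c-\tilde{\mathbf u}\le\mathbf r,\ \mathbf u_c\ge\mathbf 0,\ \tilde{\mathbf u}\ge\mathbf 0\}.$$ Let $\dot u(\tilde{\mathbf u})=0$ if $\tilde{\mathbf u}=\mathbf 0$ and $\dot u(\tilde{\mathbf u})=+\infty$ otherwise. For a function $M:\mathcal X\to\mathbb R$ and sets $S_o\subseteq\mathbb U_d\times\mathcal P_\Pi$, $S_f\subseteq\mathbb U_d\times\mathcal R_\Pi$, let $\mathbf{SL}_M(S_o,S_f)$ be the following single-level program, with separate variables $\mathbf y,\mathbf u_c,\tilde{\mathbf u},\lambda$ (respectively $\mathbf y,\mathbf v_c,\tilde{\mathbf v},\zeta$) for each enumerated pair: $$\begin{aligned} \min\ & \mathbf c_1\mathbf x+\eta\qquad\text{s.t. } \mathbf x\in\mathcal X,\ \eta\in\mathbb R,\\ &\Big\{\eta\ge\mathbf c_2\mathbf y^{(\mathbf u_d,\pi)}-\dot u(\tilde{\mathbf u}^{(\mathbf u_d,\pi)}),\quad \mathbf y^{(\mathbf u_d,\pi)}\ge\mathbf 0,\\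 &\ \ \mathbf B_2\mathbf y^{(\mathbf u_d,\pi)}+\mathbf E_c\mathbf u_c^{(\mathbf u_d,\pi)}+\dot u(\tilde{\mathbf u}^{(\mathbf u_d,\pi)})\mathbf 1\ge\mathbf d-\mathbf B_1\mathbf x-\mathbf E_d\mathbf u_d,\\ &\ \ (\mathbf u_c^{(\mathbf u_d,\pi)},\tilde{\mathbf u}^{(\mathbf u_d,\pi)},\lambda^{(\mathbf u_d,\pi)})\in\mathcal O_{M(\mathbf x)}(\mathbf x,\mathbf u_d,\pi)\Big\}\quad\forall(\mathbf u_d,\pi)\in S_o,\\ &\Big\{\mathbf B_2\mathbf y^{(\mathbf u_d,\gamma)}+\mathbf E_c\mathbf v_c^{(\mathbf u_d,\gamma)}+\dot u(\tilde{\mathbf v}^{(\mathbf u_d,\gamma)})\mathbf 1\ge\mathbf d-\mathbf B_1\mathbf x-\mathbf E_d\mathbf u_d,\quad \mathbf y^{(\mathbf u_d,\gamma)}\ge\mathbf 0,\\ &\ \ (\mathbf v_c^{(\mathbf u_d,\gamma)},\tilde{\mathbf v}^{(\mathbf u_d,\gamma)},\zeta^{(\mathbf u_d,\gamma)})\in\mathcal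 O_{M(\mathbf x)}(\mathbf x,\mathbf u_d,\gamma)\Big\}\quad\forall(\mathbf u_d,\gamma)\in S_f . \end{aligned}$$ Two programs are *equivalent* if they have the same optimal value and every optimal first-stage solution $\mathbf x$ of either one is an optimal first-stage solution of the other. **Statement.** Assume (A1)–(A3). If the penalty coefficient is sufficiently large, then $\mathbf{2\text{-}Stg\ RO}$ is equivalent to the single-level program that enumerates all pairs, and every restriction to subsets of the pairs is a relaxation. Precisely, there is a real-valued function $\mu$ on matrices such that for every $M:\mathcal X\to\mathbb R$ with $M(\mathbf x)\ge\mu(\mathbf F_c(\mathbf x))$ for all $\mathbf x\in\mathcal X$ (in particular, for all sufficiently large constants $M$ if $\mathbf F_c(\cdot)$ takes finitely many values on $\mathcal X$): 1. $\mathbf{2\text{-}Stg\ RO}$, and hence every program equivalent to it, is equivalent to $\mathbf{SL}_M(\mathbb U_d\times\mathcal P_\Pi,\ \mathbb U_d\times\mathcal R_\Pi)$. 2. For all $S_o\subseteq\mathbb U_d\times\mathcal P_\Pi$ and $S_f\subseteq\mathbb U_d\times\mathcal R_\Pi$, the program $\mathbf{SL}_M(S_o,S_f)$ is a relaxation of $\mathbf{2\text{-}Stg\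 RO}$ (each feasible $\mathbf x$ of $\mathbf{2\text{-}Stg\ RO}$ extends to a feasible solution of $\mathbf{SL}_M(S_o,S_f)$ whose objective value does not exceed that of $\mathbf x$), and its optimal value is at most $w^*$. -/

import Mathlib

open scoped Matrix

/-- An abstract optimization (minimization) problem whose solutions carry a first-stage decision of
type `X`. -/
structure Program (X : Type) where
  Sol : Type
  feasible : Set Sol
  objective : Sol → EReal
  firstStage : Sol → X

namespace Program

variable {X : Type}

/-- The infimum of the objective over the feasible set; it is `+∞` when the program is infeasible. -/
noncomputable def optimalValue (P : Program X) : EReal :=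
  ⨅ s ∈ P.feasible, P.objective s

def IsOptimal (P : Program X) (s : P.Sol) : Prop :=
  s ∈ P.feasible ∧ P.objective s = P.optimalValue

/-- `x` is an optimal first-stage solution: the first-stage part of some optimal solution. -/
def IsOptimalFirstStage (P : Program X) (x : X) : Prop :=
  ∃ s : P.Sol, P.IsOptimal s ∧ P.firstStage s = x

/-- Two programs are equivalent when they have the same optimal value and an optimal first-stage
solution of either one is an optimal first-stage solution of the other one. -/
def Equivalent (P Q : Program X) : Prop :=
  P.optimalValue = Q.optimalValue ∧
    ∀ x : X, P.IsOptimalFirstStage x ↔ Q.IsOptimalFirstStage x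

/-- `P` is a relaxation of `Q`: every feasible solution of `Q` is matched by a feasible solution of
`P` with the same first-stage decision and an objective value that is not larger. -/
def IsRelaxationOf (P Q : Program X) : Prop :=
  ∀ t ∈ Q.feasible, ∃ s ∈ P.feasible,
    P.firstStage s = Q.firstStage t ∧ P.objective s ≤ Q.objective t

end Program

/-- First-stage decisions `x = (x_c, x_d)`; the discrete part has nonnegative integer entries. -/
abbrev FirstStage (nx mx : ℕ) : Type := (Fin nx → ℝ) × (Fin mx → ℕ)

/-- A vector of nonnegative integers, read as a real vector. -/
def natVec {m : ℕ} (z : Fin m → ℕ) : Fin m → ℝ := fun j => (z j : ℝ)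

/-- `x = (x_c, x_d)` as one real vector. -/
def FirstStage.vec {nx mx : ℕ} (x : FirstStage nx mx) : Fin nx ⊕ Fin mx → ℝ :=
  Sum.elim x.1 (natVec x.2)

/-- The coefficients of a two-stage robust program with a mixed-integer decision-dependent
uncertainty set and a linear recourse problem. `p`, `q`, `r` are the numbers of rows of the
first-stage system, of the uncertainty set and of the recourse problem. -/
structure TwoStageData (nx mx p nu mu q ny r : ℕ) where
  c₁ : Fin nx ⊕ Fin mx → ℝ
  c₂ : Fin ny → ℝ
  A : Matrix (Fin p) (Fin nx ⊕ Fin mx) ℝ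
  b : Fin p → ℝ
  /-- the finite set of discrete scenarios, a subset of the nonnegative integer vectors -/
  Ud : Finset (Fin mu → ℕ)
  Fc : FirstStage nx mx → Matrix (Fin q) (Fin nu) ℝ
  Fd : FirstStage nx mx → Matrix (Fin q) (Fin mu) ℝ
  h : Fin q → ℝ
  G : Matrix (Fin q) (Fin nx ⊕ Fin mx) ℝ
  d : Fin r → ℝ
  B₁ : Matrix (Fin r) (Fin nx ⊕ Fin mx) ℝ
  B₂ : Matrix (Fin r) (Fin ny) ℝ
  Ec : Matrix (Fin r) (Fin nu) ℝ
  Ed : Matrix (Fin r) (Fin mu) ℝ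

/-- The function that is `0` at the zero vector and `+∞` at every other vector. -/
noncomputable def penalty {q : ℕ} (w : Fin q → ℝ) : EReal :=
  open Classical in if w = 0 then 0 else ⊤

namespace TwoStageData

variable {nx mx p nu mu q ny r : ℕ} (D : TwoStageData nx mx p nu mu q ny r)

/-- The first-stage feasible set `X`. -/
def X : Set (FirstStage nx mx) :=
  {x | 0 ≤ x.1 ∧ D.b ≤ D.A *ᵥ x.vec}

/-- The uncertainty set `U(x)`, consisting of pairs `(u_c, u_d)`. -/
def U (x : FirstStage nx mx) : Set ((Fin nu → ℝ) × (Fin mu → ℕ)) :=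
  {u | 0 ≤ u.1 ∧ u.2 ∈ D.Ud ∧
    D.Fc x *ᵥ u.1 + D.Fd x *ᵥ natVec u.2 ≤ D.h + D.G *ᵥ x.vec}

/-- The recourse feasible set `Y(x, u)`. -/
def Y (x : FirstStage nx mx) (u : (Fin nu → ℝ) × (Fin mu → ℕ)) : Set (Fin ny → ℝ) :=
  {y | 0 ≤ y ∧
    D.d - D.B₁ *ᵥ x.vec - D.Ec *ᵥ u.1 - D.Ed *ᵥ natVec u.2 ≤ D.B₂ *ᵥ y}

/-- The two-stage program `min_{x ∈ X} c₁ x + max_{u ∈ U(x)} min_{y ∈ Y(x,u)} c₂ y`. A decision `x` is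
feasible when the recourse problem is feasible for every scenario in `U(x)`. -/
noncomputable def twoStageRO : Program (FirstStage nx mx) where
  Sol := FirstStage nx mx
  feasible := {x | x ∈ D.X ∧ ∀ u ∈ D.U x, (D.Y x u).Nonempty}
  objective x := ((D.c₁ ⬝ᵥ x.vec : ℝ) : EReal) +
    ⨆ u ∈ D.U x, ⨅ y ∈ D.Y x u, ((D.c₂ ⬝ᵥ y : ℝ) : EReal)
  firstStage x := x

/-- The feasible set `Π` of the dual of the recourse problem. -/
def dualPolyhedron : Set (Fin r → ℝ) :=
  {π | D.B₂ᵀ *ᵥ π ≤ D.c₂ ∧ 0 ≤ π}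

/-- The set of extreme points of `Π`. -/
def extremePts : Set (Fin r → ℝ) := Set.extremePoints ℝ D.dualPolyhedron

/-- The cone of recession directions of `Π`. -/
def recessionCone : Set (Fin r → ℝ) :=
  {γ | D.B₂ᵀ *ᵥ γ ≤ 0 ∧ 0 ≤ γ}

/-- `γ` spans an extreme ray of `Π`: it is a nonzero recession direction, and recession directions
that add up to `γ` are nonnegative multiples of `γ`. -/
def IsExtremeRay (γ : Fin r → ℝ) : Prop :=
  γ ∈ D.recessionCone ∧ γ ≠ 0 ∧
    ∀ α ∈ D.recessionCone, ∀ β ∈ D.recessionCone, α + β = γ →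
      (∃ s : ℝ, 0 ≤ s ∧ α = s • γ) ∧ ∃ t : ℝ, 0 ≤ t ∧ β = t • γ

/-- `R` lists the extreme rays of `Π`, each of them by exactly one generating vector. -/
def IsExtremeRaySystem (R : Set (Fin r → ℝ)) : Prop :=
  (∀ γ ∈ R, D.IsExtremeRay γ) ∧
    ∀ δ, D.IsExtremeRay δ → ∃! γ, γ ∈ R ∧ ∃ t : ℝ, 0 < t ∧ δ = t • γ

/-- The Karush-Kuhn-Tucker system, in `(u_c, ũ, λ)`, of the linear program
`max (-E_c u_c)ᵀ β - m 1ᵀ ũ` subject to `F_c(x) u_c - ũ ≤ h + G x - F_d(x) u_d`, `u_c ≥ 0`, `ũ ≥ 0`. -/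
def KKT (m : ℝ) (x : FirstStage nx mx) (ud : Fin mu → ℕ) (β : Fin r → ℝ) :
    Set ((Fin nu → ℝ) × (Fin q → ℝ) × (Fin q → ℝ)) :=
  {z | let uc := z.1
       let ut := z.2.1
       let lam := z.2.2
       let rhs := D.h + D.G *ᵥ x.vec - D.Fd x *ᵥ natVec ud
       D.Fc x *ᵥ uc - ut ≤ rhs ∧
       -(D.Ecᵀ *ᵥ β) ≤ (D.Fc x)ᵀ *ᵥ lam ∧
       (∀ i, lam i ≤ m) ∧
       (∀ i, lam i * (rhs i - (D.Fc x *ᵥ uc) i + ut i) = 0) ∧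
       (∀ j, uc j * (((D.Fc x)ᵀ *ᵥ lam) j + (D.Ecᵀ *ᵥ β) j) = 0) ∧
       (∀ i, ut i * (m - lam i) = 0) ∧
       0 ≤ uc ∧ 0 ≤ ut ∧ 0 ≤ lam}

/-- The variables of the single-level program: `x`, `η`, and for every enumerated pair one copy of
the recourse variable together with one copy of the Karush-Kuhn-Tucker variables. `So` and `Sf` are
the sets of enumerated pairs `(u_d, π)` and `(u_d, γ)`. -/
structure SingleLevelVars (nx mx nu mu q ny r : ℕ) (So Sf : Set ((Fin mu → ℕ) × (Fin r → ℝ))) where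
  x : FirstStage nx mx
  η : ℝ
  y : So → Fin ny → ℝ
  uc : So → Fin nu → ℝ
  ut : So → Fin q → ℝ
  lam : So → Fin q → ℝ
  yf : Sf → Fin ny → ℝ
  vc : Sf → Fin nu → ℝ
  vt : Sf → Fin q → ℝ
  zeta : Sf → Fin q → ℝ

/-- The recourse constraint with the penalty term on its left-hand side,
`B₂ y + E_c u_c + penalty(ũ) ≥ d - B₁ x - E_d u_d`, in extended real numbers. -/
def PenalizedRecourse (x : FirstStage nx mx) (ud : Fin mu → ℕ)
    (y : Fin ny → ℝ) (uc : Fin nu → ℝ) (ut : Fin q → ℝ) : Prop :=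
  ∀ i, (((D.d - D.B₁ *ᵥ x.vec - D.Ed *ᵥ natVec ud) i : ℝ) : EReal) ≤
    (((D.B₂ *ᵥ y + D.Ec *ᵥ uc) i : ℝ) : EReal) + penalty ut

/-- The single-level program that enumerates the pairs in `So` (optimality blocks) and in `Sf`
(feasibility blocks), with penalty coefficient `M x` in the inner linear programs at `x`. -/
noncomputable def singleLevel (M : FirstStage nx mx → ℝ)
    (So Sf : Set ((Fin mu → ℕ) × (Fin r → ℝ))) : Program (FirstStage nx mx) where
  Sol := SingleLevelVars nx mx nu mu q ny r So Sf
  feasible := {s | s.x ∈ D.X ∧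
    (∀ k : So,
      ((D.c₂ ⬝ᵥ s.y k : ℝ) : EReal) - penalty (s.ut k) ≤ (s.η : EReal) ∧
      0 ≤ s.y k ∧
      D.PenalizedRecourse s.x k.1.1 (s.y k) (s.uc k) (s.ut k) ∧
      (s.uc k, s.ut k, s.lam k) ∈ D.KKT (M s.x) s.x k.1.1 k.1.2) ∧
    (∀ k : Sf,
      D.PenalizedRecourse s.x k.1.1 (s.yf k) (s.vc k) (s.vt k) ∧
      0 ≤ s.yf k ∧
      (s.vc k, s.vt k, s.zeta k) ∈ D.KKT (M s.x) s.x k.1.1 k.1.2)}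
  objective s := ((D.c₁ ⬝ᵥ s.x.vec + s.η : ℝ) : EReal)
  firstStage s := s.x

end TwoStageData

/-! By LP duality, the recourse problem is feasible iff its right-hand side is nonpositive on the
extreme rays of `Π`, and its value is then attained at an extreme point of `Π` (`Y_nonempty`,
`exists_optimal_recourse`). So for fixed `x` and `u_d`, only finitely many `β` matter, and for each
of them the worst `u_c` solves a linear program, encoded by its KKT system. The fiber of `U(x)` over
`u_d` may be empty. The penalized program is still feasible then, and a nonzero `ũ` makes its block
vacuous. Exactness asks that `ũ = 0` whenever the fiber is nonempty (`PenaltyKKT.exact`). The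
threshold depends on `F_c(x)` alone because the dual feasible set does not involve the right-hand
side: a dual optimum may be replaced by any dual point with the same zero coordinates and tight
constraints, and there are finitely many such patterns (`exists_hasDualBound`). Equivalence is
relaxation in both directions. From a single-level solution, the block of `(u_d, β)` bounds the
value of `β` at every `u` over `u_d`. Conversely, boundedness of `U(x)` makes each KKT system
solvable (`KKT_nonempty`), and an optimal recourse decision, or a vacuous block, completes it
(`exists_block`); this works for any subset of the pairs. -/

/-! ### Farkas' lemma and linear programming duality. -/

/-- **Farkas' lemma** for finitely many linear functionals. -/
theorem farkas_functionals {V ι : Type*} [AddCommGroup V] [Module ℝ V] (s : Finset ι) :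
    ∀ (a : ι → V →ₗ[ℝ] ℝ) (c : V →ₗ[ℝ] ℝ), (∀ v, (∀ i ∈ s, a i v ≤ 0) → c v ≤ 0) →
      ∃ l : ι → ℝ, (∀ i, 0 ≤ l i) ∧ ∀ v, c v = ∑ i ∈ s, l i * a i v := by
  classical
  induction s using Finset.induction_on with
  | empty =>
    intro a c h
    refine ⟨0, fun _ => le_rfl, fun v => ?_⟩
    have h1 := h v (by simp)
    have h2 := h (-v) (by simp)
    rw [map_neg] at h2
    simp only [Finset.sum_empty]
    linarith
  | insert k s hk ih =>
    intro a c h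
    by_cases hc : ∀ v, (∀ i ∈ s, a i v ≤ 0) → c v ≤ 0
    · obtain ⟨l, hl, hl'⟩ := ih a c hc
      refine ⟨Function.update l k 0, fun i => ?_, fun v => ?_⟩
      · by_cases hi : i = k
        · subst hi; simp
        · simp [hi, hl i]
      · rw [Finset.sum_insert hk, hl' v]
        simp only [Function.update_self, zero_mul, zero_add]
        refine Finset.sum_congr rfl fun i hi => ?_
        rw [Function.update_of_ne (ne_of_mem_of_not_mem hi hk)]
    · push Not at hc
      obtain ⟨v₁, hv₁, hcv₁⟩ := hc
      have hpos : 0 < a k v₁ := by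
        by_contra hn
        refine absurd (h v₁ fun i hi => ?_) (not_le.2 hcv₁)
        rcases Finset.mem_insert.1 hi with rfl | hi
        · exact not_lt.1 hn
        · exact hv₁ i hi
      obtain ⟨v₀, hv₀, hcv₀, hkv₀⟩ :
          ∃ v₀, (∀ i ∈ s, a i v₀ ≤ 0) ∧ 0 < c v₀ ∧ a k v₀ = 1 := by
        refine ⟨(a k v₁)⁻¹ • v₁, fun i hi => ?_, ?_, ?_⟩
        · rw [map_smul, smul_eq_mul]
          exact mul_nonpos_of_nonneg_of_nonpos (inv_nonneg.2 hpos.le) (hv₁ i hi)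
        · rw [map_smul, smul_eq_mul]
          exact mul_pos (inv_pos.2 hpos) hcv₁
        · rw [map_smul, smul_eq_mul, inv_mul_cancel₀ hpos.ne']
      -- These are the functionals composed with the projection `v ↦ v - a k v • v₀` onto the kernel
      -- of `a k`, where constraint `k` holds automatically.
      obtain ⟨l, hl, hl'⟩ := ih (fun i => a i - a i v₀ • a k) (c - c v₀ • a k) (by
        intro v hv
        have := h (v - a k v • v₀) (by
          intro i hi
          rcases Finset.mem_insert.1 hi with rfl | hi
          · simp [hkv₀]
          · have := hv i hi
            simp only [LinearMap.sub_apply, LinearMap.smul_apply, smul_eq_mul] at this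
            rw [map_sub, map_smul, smul_eq_mul]
            linarith)
        rw [map_sub, map_smul, smul_eq_mul] at this
        simp only [LinearMap.sub_apply, LinearMap.smul_apply, smul_eq_mul]
        linarith)
      have hsum : ∑ i ∈ s, l i * a i v₀ ≤ 0 :=
        Finset.sum_nonpos fun i hi => mul_nonpos_of_nonneg_of_nonpos (hl i) (hv₀ i hi)
      refine ⟨Function.update l k (c v₀ - ∑ i ∈ s, l i * a i v₀), fun i => ?_, fun v => ?_⟩
      · by_cases hi : i = k
        · subst hi
          rw [Function.update_self]
          linarith
        · simp [hi, hl i]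
      · rw [Finset.sum_insert hk, Function.update_self]
        have h1 : ∑ i ∈ s, Function.update l k (c v₀ - ∑ i ∈ s, l i * a i v₀) i * a i v
            = ∑ i ∈ s, l i * a i v := by
          refine Finset.sum_congr rfl fun i hi => ?_
          rw [Function.update_of_ne (ne_of_mem_of_not_mem hi hk)]
        have h2 := hl' v
        simp only [LinearMap.sub_apply, LinearMap.smul_apply, smul_eq_mul, mul_sub,
          Finset.sum_sub_distrib] at h2
        have h3 : ∑ i ∈ s, l i * (a i v₀ * a k v) = (∑ i ∈ s, l i * a i v₀) * a k v := by
          rw [Finset.sum_mul]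
          exact Finset.sum_congr rfl fun i _ => by ring
        rw [h1]
        linarith

section LinearProgramming

variable {m n : Type*} [Fintype m] [Fintype n]

/-- **Farkas' lemma** for a system of linear inequalities in nonnegative variables. -/
theorem farkas_matrix (A : Matrix m n ℝ) (b : m → ℝ)
    (h : ∀ γ : m → ℝ, 0 ≤ γ → Aᵀ *ᵥ γ ≤ 0 → b ⬝ᵥ γ ≤ 0) :
    ∃ y : n → ℝ, 0 ≤ y ∧ b ≤ A *ᵥ y := by
  classical
  obtain ⟨l, hl, hl'⟩ := farkas_functionals (V := m → ℝ) (Finset.univ : Finset (m ⊕ n))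
    (Sum.elim (fun i => -LinearMap.proj i) fun j => (LinearMap.proj j).comp Aᵀ.mulVecLin)
    (dotProductBilin ℝ ℝ b) (by
      intro γ hγ
      refine h γ (fun i => ?_) fun j => ?_
      · simpa using hγ (Sum.inl i) (Finset.mem_univ _)
      · exact hγ (Sum.inr j) (Finset.mem_univ _))
  refine ⟨fun j => l (Sum.inr j), fun j => hl _, fun i => ?_⟩
  -- At a basis vector the identity reads `b i = -l (inl i) + (A y) i`, with `y` the multipliers of
  -- the column constraints.
  have := hl' (Pi.single i 1)
  simp [Fintype.sum_sum_type, Pi.single_apply] at this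
  rw [this]
  have h0 := hl (Sum.inl i)
  have h1 : ∑ x, l (Sum.inr x) * A i x = (A *ᵥ fun j => l (Sum.inr j)) i := by
    rw [Matrix.mulVec, dotProduct]
    exact Finset.sum_congr rfl fun _ _ => mul_comm _ _
  linarith

theorem dotProduct_mulVec_eq (A : Matrix m n ℝ) (p : m → ℝ) (y : n → ℝ) :
    p ⬝ᵥ A *ᵥ y = (Aᵀ *ᵥ p) ⬝ᵥ y := by
  rw [Matrix.dotProduct_mulVec, Matrix.mulVec_transpose]

theorem dotProduct_le_of_le {p v w : m → ℝ} (hp : 0 ≤ p) (h : v ≤ w) : p ⬝ᵥ v ≤ p ⬝ᵥ w :=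
  dotProduct_le_dotProduct_of_nonneg_left h hp

/-- **Weak duality**. -/
theorem weak_duality {A : Matrix m n ℝ} {b : m → ℝ} {c : n → ℝ} {y : n → ℝ} {p : m → ℝ}
    (hy : 0 ≤ y) (hAy : b ≤ A *ᵥ y) (hp : 0 ≤ p) (hAp : Aᵀ *ᵥ p ≤ c) : b ⬝ᵥ p ≤ c ⬝ᵥ y :=
  calc b ⬝ᵥ p = p ⬝ᵥ b := dotProduct_comm _ _
    _ ≤ p ⬝ᵥ A *ᵥ y := dotProduct_le_of_le hp hAy
    _ = y ⬝ᵥ Aᵀ *ᵥ p := by rw [dotProduct_mulVec_eq, dotProduct_comm]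
    _ ≤ y ⬝ᵥ c := dotProduct_le_of_le hy hAp
    _ = c ⬝ᵥ y := dotProduct_comm _ _

/-- A linear program that is feasible and bounded below by `z` has a dual solution of value at
least `z`. -/
theorem exists_dual_of_le (A : Matrix m n ℝ) (b : m → ℝ) (c : n → ℝ) (z : ℝ)
    {y₀ : n → ℝ} (hy₀ : 0 ≤ y₀) (hAy₀ : b ≤ A *ᵥ y₀)
    (hz : ∀ y, 0 ≤ y → b ≤ A *ᵥ y → z ≤ c ⬝ᵥ y) :
    ∃ p : m → ℝ, 0 ≤ p ∧ Aᵀ *ᵥ p ≤ c ∧ z ≤ b ⬝ᵥ p := by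
  obtain ⟨p, hp, hp'⟩ := farkas_matrix (m := n ⊕ Unit)
    (Matrix.fromRows (-Aᵀ) (Matrix.replicateRow Unit b)) (Sum.elim (-c) fun _ => z) (by
      intro γ hγ hγ'
      obtain ⟨y, t, rfl⟩ : ∃ (y : n → ℝ) (t : ℝ), γ = Sum.elim y fun _ => t :=
        ⟨fun j => γ (Sum.inl j), γ (Sum.inr ()), by ext (j | j) <;> rfl⟩
      have hy : 0 ≤ y := fun j => hγ (Sum.inl j)
      have ht : 0 ≤ t := hγ (Sum.inr ())
      have hAy : t • b ≤ A *ᵥ y := by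
        intro i
        have := hγ' i
        simp [Matrix.mulVec, dotProduct, Fintype.sum_sum_type] at this
        simp only [Pi.smul_apply, smul_eq_mul, Matrix.mulVec, dotProduct]
        linarith
      -- If `t > 0`, rescale `y` to a feasible point. If `t = 0`, `y` is a recession direction; were
      -- `c ⬝ᵥ y` negative, the `k` below would give `y₀ + k • y` the value `z - 1`.
      have key : t * z ≤ c ⬝ᵥ y := by
        rcases ht.eq_or_lt with rfl | ht
        · rw [zero_smul] at hAy
          rw [zero_mul]
          by_contra hneg
          push Not at hneg
          obtain ⟨k, hk, hk'⟩ : ∃ k : ℝ, 0 ≤ k ∧ c ⬝ᵥ y₀ + k * (c ⬝ᵥ y) < z := by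
            refine ⟨(c ⬝ᵥ y₀ - z + 1) / (-(c ⬝ᵥ y)), ?_, ?_⟩
            · have := hz y₀ hy₀ hAy₀
              exact div_nonneg (by linarith) (by linarith)
            · have : (c ⬝ᵥ y₀ - z + 1) / (-(c ⬝ᵥ y)) * (c ⬝ᵥ y) = -(c ⬝ᵥ y₀ - z + 1) := by
                rw [div_neg, neg_mul, div_mul_cancel₀ _ hneg.ne]
              rw [this]
              linarith
          have := hz (y₀ + k • y) (add_nonneg hy₀ (smul_nonneg hk hy)) (by
            rw [Matrix.mulVec_add, Matrix.mulVec_smul]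
            exact le_add_of_le_of_nonneg hAy₀ (smul_nonneg hk hAy))
          rw [dotProduct_add, dotProduct_smul, smul_eq_mul] at this
          linarith
        · have := hz (t⁻¹ • y) (smul_nonneg (inv_nonneg.2 ht.le) hy) (by
            rw [Matrix.mulVec_smul]
            have := smul_le_smul_of_nonneg_left hAy (inv_nonneg.2 ht.le)
            rwa [smul_smul, inv_mul_cancel₀ ht.ne', one_smul] at this)
          rw [dotProduct_smul, smul_eq_mul, inv_mul_eq_div, le_div_iff₀ ht] at this
          linarith
      simp only [dotProduct, Fintype.sum_sum_type, Sum.elim_inl, Sum.elim_inr, Pi.neg_apply,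
        Finset.univ_unique, Finset.sum_const, Finset.card_singleton, one_smul, neg_mul,
        Finset.sum_neg_distrib] at key ⊢
      linarith)
  refine ⟨p, hp, fun j => ?_, ?_⟩
  · have := hp' (Sum.inl j)
    simp [Matrix.neg_mulVec] at this
    exact this
  · have := hp' (Sum.inr ())
    simp [Matrix.mulVec] at this
    exact this

/-- **Strong duality** with attainment on both sides. -/
theorem exists_optimal_pair (A : Matrix m n ℝ) (b : m → ℝ) (c : n → ℝ) (w : ℝ)
    {y₀ : n → ℝ} (hy₀ : 0 ≤ y₀) (hAy₀ : b ≤ A *ᵥ y₀)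
    (hw : ∀ y, 0 ≤ y → b ≤ A *ᵥ y → w ≤ c ⬝ᵥ y) :
    ∃ (y : n → ℝ) (p : m → ℝ), 0 ≤ y ∧ b ≤ A *ᵥ y ∧ 0 ≤ p ∧ Aᵀ *ᵥ p ≤ c ∧
      c ⬝ᵥ y = b ⬝ᵥ p := by
  set S : Set ℝ := {v | ∃ y : n → ℝ, 0 ≤ y ∧ b ≤ A *ᵥ y ∧ v = c ⬝ᵥ y} with hS
  have hSne : S.Nonempty := ⟨_, y₀, hy₀, hAy₀, rfl⟩
  have hSb : BddBelow S := ⟨w, by rintro _ ⟨y, hy, hy', rfl⟩; exact hw y hy hy'⟩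
  obtain ⟨p, hp, hAp, hbp⟩ := exists_dual_of_le A b c (sInf S) hy₀ hAy₀
    fun y hy hy' => csInf_le hSb ⟨y, hy, hy', rfl⟩
  -- The dual, rewritten as a minimization, has as its own dual the primal, so the same lemma yields
  -- a primal point attaining the infimum.
  obtain ⟨y, hy, hAy, hcy⟩ := exists_dual_of_le (-Aᵀ) (-c) (-b) (-sInf S) hp
    (by rw [Matrix.neg_mulVec]; exact neg_le_neg hAp) (by
      intro p' hp' hAp'
      rw [Matrix.neg_mulVec] at hAp'
      rw [neg_dotProduct]
      refine neg_le_neg (le_csInf hSne ?_)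
      rintro _ ⟨y, hy, hy', rfl⟩
      exact weak_duality hy hy' hp' (neg_le_neg_iff.1 hAp'))
  rw [Matrix.transpose_neg, Matrix.transpose_transpose, Matrix.neg_mulVec, neg_le_neg_iff] at hAy
  rw [neg_dotProduct, neg_le_neg_iff] at hcy
  exact ⟨y, p, hy, hAy, hp, hAp, le_antisymm (hcy.trans hbp) (weak_duality hy hAy hp hAp)⟩

theorem mul_eq_zero_of_dotProduct_eq_zero {v w : m → ℝ} (hv : 0 ≤ v) (hw : 0 ≤ w)
    (h : v ⬝ᵥ w = 0) (i : m) : v i * w i = 0 :=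
  (Finset.sum_eq_zero_iff_of_nonneg fun i _ => mul_nonneg (hv i) (hw i)).1 h i (Finset.mem_univ i)

/-- **Complementary slackness**. -/
theorem complementary_slackness {A : Matrix m n ℝ} {b : m → ℝ} {c : n → ℝ} {y : n → ℝ} {p : m → ℝ}
    (hy : 0 ≤ y) (hAy : b ≤ A *ᵥ y) (hp : 0 ≤ p) (hAp : Aᵀ *ᵥ p ≤ c) (h : c ⬝ᵥ y = b ⬝ᵥ p) :
    (∀ i, p i * ((A *ᵥ y) i - b i) = 0) ∧ ∀ j, y j * (c j - (Aᵀ *ᵥ p) j) = 0 := by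
  have h1 : 0 ≤ A *ᵥ y - b := sub_nonneg.2 hAy
  have h2 : 0 ≤ c - Aᵀ *ᵥ p := sub_nonneg.2 hAp
  have e1 : 0 ≤ p ⬝ᵥ (A *ᵥ y - b) := dotProduct_nonneg_of_nonneg hp h1
  have e2 : 0 ≤ y ⬝ᵥ (c - Aᵀ *ᵥ p) := dotProduct_nonneg_of_nonneg hy h2
  have e3 : p ⬝ᵥ (A *ᵥ y - b) + y ⬝ᵥ (c - Aᵀ *ᵥ p) = 0 := by
    rw [dotProduct_sub, dotProduct_sub, dotProduct_mulVec_eq, dotProduct_comm y (Aᵀ *ᵥ p),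
      dotProduct_comm y c, dotProduct_comm p b]
    linarith
  have e4 : p ⬝ᵥ (A *ᵥ y - b) = 0 := by linarith
  have e5 : y ⬝ᵥ (c - Aᵀ *ᵥ p) = 0 := by linarith
  exact ⟨mul_eq_zero_of_dotProduct_eq_zero hp h1 e4, mul_eq_zero_of_dotProduct_eq_zero hy h2 e5⟩

/-! ### Uniform dual bounds and exact penalization. -/

theorem Set.Finite.exists_forall_of_mono {α : Type*} {s : Set α} (hs : s.Finite)
    {P : α → ℝ → Prop} (hmono : ∀ a K K', K ≤ K' → P a K → P a K')
    (h : ∀ a ∈ s, ∃ K, P a K) : ∃ K, ∀ a ∈ s, P a K := by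
  choose! f hf using h
  obtain ⟨K, hK⟩ := (hs.image f).bddAbove
  exact ⟨K, fun a ha => hmono a _ K (hK (Set.mem_image_of_mem f ha)) (hf a ha)⟩

/-- Every feasible point of `{l ≥ 0 : Aᵀ l ≥ c}` can be replaced by one with entries at most `K`
without losing any active constraint. -/
def HasDualBound (A : Matrix m n ℝ) (c : n → ℝ) (K : ℝ) : Prop :=
  ∀ l : m → ℝ, 0 ≤ l → c ≤ Aᵀ *ᵥ l →
    ∃ l' : m → ℝ, 0 ≤ l' ∧ c ≤ Aᵀ *ᵥ l' ∧ (∀ i, l' i ≤ K) ∧ (∀ i, l i = 0 → l' i = 0) ∧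
      ∀ j, (Aᵀ *ᵥ l) j = c j → (Aᵀ *ᵥ l') j = c j

omit [Fintype n] in
theorem HasDualBound.mono {A : Matrix m n ℝ} {c : n → ℝ} {K K' : ℝ} (hKK : K ≤ K')
    (h : HasDualBound A c K) : HasDualBound A c K' := by
  intro l h1 h2
  obtain ⟨l', g1, g2, g3, g4⟩ := h l h1 h2
  exact ⟨l', g1, g2, fun i => (g3 i).trans hKK, g4⟩

/-- Pick one dual point for each realizable pair (zero coordinates, tight constraints). The pairs
are finitely many, so the chosen points have a common bound. -/
theorem exists_hasDualBound (A : Matrix m n ℝ) (c : n → ℝ) : ∃ K, HasDualBound A c K := by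
  obtain ⟨K, hK⟩ := (Set.toFinite (Set.univ : Set (Set m × Set n))).exists_forall_of_mono
    (P := fun a K => ∀ l : m → ℝ, 0 ≤ l → c ≤ Aᵀ *ᵥ l → {i | l i = 0} = a.1 →
      {j | (Aᵀ *ᵥ l) j = c j} = a.2 →
      ∃ l' : m → ℝ, 0 ≤ l' ∧ c ≤ Aᵀ *ᵥ l' ∧ (∀ i, l' i ≤ K) ∧ (∀ i ∈ a.1, l' i = 0) ∧
        ∀ j ∈ a.2, (Aᵀ *ᵥ l') j = c j)
    (by
      intro a K K' hKK h l h1 h2 h3 h4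
      obtain ⟨l', g1, g2, g3, g4⟩ := h l h1 h2 h3 h4
      exact ⟨l', g1, g2, fun i => (g3 i).trans hKK, g4⟩)
    (by
      rintro ⟨I, J⟩ -
      by_cases hex : ∃ l : m → ℝ, 0 ≤ l ∧ c ≤ Aᵀ *ᵥ l ∧ {i | l i = 0} = I ∧
        {j | (Aᵀ *ᵥ l) j = c j} = J
      · obtain ⟨l, h1, h2, rfl, rfl⟩ := hex
        obtain ⟨K, hK⟩ := (Set.finite_range l).bddAbove
        exact ⟨K, fun _ _ _ _ _ => ⟨l, h1, h2, fun i => hK (Set.mem_range_self i),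
          fun i hi => hi, fun j hj => hj⟩⟩
      · exact ⟨0, fun l h1 h2 h3 h4 => absurd ⟨l, h1, h2, h3, h4⟩ hex⟩)
  refine ⟨K, fun l h1 h2 => ?_⟩
  obtain ⟨l', g1, g2, g3, g4, g5⟩ := hK ({i | l i = 0}, {j | (Aᵀ *ᵥ l) j = c j})
    (Set.mem_univ _) l h1 h2 rfl rfl
  exact ⟨l', g1, g2, g3, fun i hi => g4 i hi, fun j hj => g5 j hj⟩

/-- The optimality system of `max c u - M 1ᵀ w` subject to `A u - w ≤ b`, `u, w ≥ 0`. -/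
structure PenaltyKKT (A : Matrix m n ℝ) (b : m → ℝ) (c : n → ℝ) (M : ℝ)
    (u : n → ℝ) (w l : m → ℝ) : Prop where
  primal : A *ᵥ u - w ≤ b
  dual : c ≤ Aᵀ *ᵥ l
  le_penalty : ∀ i, l i ≤ M
  slack_row : ∀ i, l i * (b i - (A *ᵥ u) i + w i) = 0
  slack_col : ∀ j, u j * ((Aᵀ *ᵥ l) j - c j) = 0
  slack_penalty : ∀ i, w i * (M - l i) = 0
  u_nonneg : 0 ≤ u
  w_nonneg : 0 ≤ w
  l_nonneg : 0 ≤ l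

/-- The penalty turns the dual into minimizing `b ⬝ᵥ l` over the dual polyhedron cut by the box `l ≤
M`, which is bounded. The multipliers of the two groups of rows are `u` and `w`, and the KKT system
is complementary slackness. -/
theorem PenaltyKKT.exists_of_dual_feasible (A : Matrix m n ℝ) (b : m → ℝ) (c : n → ℝ) (M : ℝ) {l₀ : m → ℝ}
    (hl₀ : 0 ≤ l₀) (hA : c ≤ Aᵀ *ᵥ l₀) (hM : ∀ i, l₀ i ≤ M) :
    ∃ u w l, PenaltyKKT A b c M u w l := by
  classical
  have hrows : ∀ l : m → ℝ, Sum.elim c (fun _ => -M) ≤ (Matrix.fromRows Aᵀ (-1 : Matrix m m ℝ)) *ᵥ l ↔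
      c ≤ Aᵀ *ᵥ l ∧ ∀ i, l i ≤ M := by
    intro l
    rw [Matrix.fromRows_mulVec, Sum.elim_le_elim_iff, Matrix.neg_mulVec, Matrix.one_mulVec]
    refine and_congr_right fun _ => forall_congr' fun i => ?_
    simp
  obtain ⟨l, p, hl, hAl, hp, hAp, heq⟩ := exists_optimal_pair
    (Matrix.fromRows Aᵀ (-1 : Matrix m m ℝ)) (Sum.elim c fun _ => -M) b (-∑ i, |b i| * |M|)
    hl₀ ((hrows l₀).2 ⟨hA, hM⟩) (by
      intro l hl hl'
      have hlM := ((hrows l).1 hl').2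
      rw [dotProduct, ← Finset.sum_neg_distrib]
      refine Finset.sum_le_sum fun i _ => ?_
      have h1 : |b i * l i| ≤ |b i| * |M| := by
        rw [abs_mul]
        refine mul_le_mul_of_nonneg_left ?_ (abs_nonneg _)
        rw [abs_of_nonneg (hl i)]
        exact (hlM i).trans (le_abs_self M)
      exact (abs_le.1 h1).1)
  obtain ⟨hs1, hs2⟩ := complementary_slackness hl hAl hp hAp heq
  obtain ⟨hA1, hA2⟩ := (hrows l).1 hAl
  have hT : ∀ i, ((Matrix.fromRows Aᵀ (-1 : Matrix m m ℝ))ᵀ *ᵥ p) i =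
      (A *ᵥ fun j => p (Sum.inl j)) i - p (Sum.inr i) := by
    intro i
    have : p = Sum.elim (fun j => p (Sum.inl j)) fun i => p (Sum.inr i) := by
      ext (j | j) <;> rfl
    rw [Matrix.transpose_fromRows, this, Matrix.fromCols_mulVec_sumElim]
    simp [Matrix.neg_mulVec, sub_eq_add_neg]
  refine ⟨fun j => p (Sum.inl j), fun i => p (Sum.inr i), l, ?_, hA1, hA2, ?_, ?_, ?_,
    fun j => hp _, fun i => hp _, hl⟩
  · intro i
    have := hAp i
    rw [hT] at this
    exact this
  · intro i
    have := hs2 i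
    rw [hT] at this
    rw [← this]
    ring
  · intro j
    have := hs1 (Sum.inl j)
    simpa [Matrix.fromRows_mulVec] using this
  · intro i
    have := hs1 (Sum.inr i)
    rw [Matrix.fromRows_mulVec, Sum.elim_inr, Sum.elim_inr, Matrix.neg_mulVec,
      Matrix.one_mulVec, Pi.neg_apply] at this
    rw [← this]
    ring

/-- **Exact penalization**: when the unpenalized program is feasible and the penalty coefficient
exceeds a bound on suitable dual solutions, the penalized optimality system forces `w = 0`. -/
theorem PenaltyKKT.exact {A : Matrix m n ℝ} {b : m → ℝ} {c : n → ℝ} {M K : ℝ}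
    (hK : HasDualBound A c K)
    (hKM : K < M) {u : n → ℝ} {w l : m → ℝ} (h : PenaltyKKT A b c M u w l)
    {u₀ : n → ℝ} (hu₀ : 0 ≤ u₀) (hAu₀ : A *ᵥ u₀ ≤ b) :
    w = 0 ∧ ∀ u', 0 ≤ u' → A *ᵥ u' ≤ b → c ⬝ᵥ u' ≤ c ⬝ᵥ u := by
  have hweak : ∀ (l' : m → ℝ) (v : m → ℝ) (u' : n → ℝ), 0 ≤ l' → c ≤ Aᵀ *ᵥ l' → 0 ≤ u' →
      A *ᵥ u' ≤ v → c ⬝ᵥ u' ≤ v ⬝ᵥ l' := by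
    intro l' v u' hl' hc hu' hv
    exact weak_duality hl' hc hu' (by rwa [Matrix.transpose_transpose])
  obtain ⟨ls, us, hls, hAls, hus, hAus, heq⟩ := exists_optimal_pair Aᵀ c b (c ⬝ᵥ u₀)
    h.l_nonneg h.dual fun l' hl' hc => hweak l' b u₀ hl' hc hu₀ hAu₀
  obtain ⟨hs1, hs2⟩ := complementary_slackness hls hAls hus hAus heq
  rw [Matrix.transpose_transpose] at hAus hs2
  obtain ⟨l', hl', hAl', hl'K, hz1, hz2⟩ := hK ls hls hAls
  -- `l'` keeps the zeros and tight constraints of `ls`, so it stays complementary to `us` and is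
  -- again dual optimal.
  have hval : c ⬝ᵥ us = b ⬝ᵥ l' := by
    have e1 : us ⬝ᵥ (Aᵀ *ᵥ l' - c) = 0 := by
      refine Finset.sum_eq_zero fun j _ => ?_
      rcases mul_eq_zero.1 (hs1 j) with h0 | h0
      · simp [h0]
      · simp [hz2 j (sub_eq_zero.1 h0)]
    have e2 : l' ⬝ᵥ (b - A *ᵥ us) = 0 := by
      refine Finset.sum_eq_zero fun i _ => ?_
      rcases mul_eq_zero.1 (hs2 i) with h0 | h0
      · simp [hz1 i h0]
      · rw [Pi.sub_apply, h0, mul_zero]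
    rw [dotProduct_sub] at e1 e2
    rw [dotProduct_mulVec_eq] at e2
    rw [dotProduct_comm us, dotProduct_comm us] at e1
    rw [dotProduct_comm l' b] at e2
    linarith
  have hkkt : c ⬝ᵥ u = b ⬝ᵥ l + M * ∑ i, w i := by
    have e1 : u ⬝ᵥ (Aᵀ *ᵥ l - c) = 0 := Finset.sum_eq_zero fun j _ => h.slack_col j
    have e2 : l ⬝ᵥ (b - A *ᵥ u + w) = 0 := Finset.sum_eq_zero fun i _ => h.slack_row i
    have e3 : M * ∑ i, w i = l ⬝ᵥ w := by
      rw [Finset.mul_sum]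
      exact Finset.sum_congr rfl fun i _ => by linarith [h.slack_penalty i]
    rw [dotProduct_sub, dotProduct_comm u, dotProduct_comm u] at e1
    rw [dotProduct_add, dotProduct_sub, dotProduct_mulVec_eq, dotProduct_comm l b] at e2
    linarith
  have h1 : c ⬝ᵥ us ≤ b ⬝ᵥ l := hweak l b us h.l_nonneg h.dual hus hAus
  have h2 : c ⬝ᵥ u ≤ (b + w) ⬝ᵥ l' :=
    hweak l' (b + w) u hl' hAl' h.u_nonneg (sub_le_iff_le_add.1 h.primal)
  rw [add_dotProduct] at h2
  -- Chain: `b ⬝ᵥ l' = c ⬝ᵥ us ≤ b ⬝ᵥ l = c ⬝ᵥ u - M * ∑ w ≤ b ⬝ᵥ l' + w ⬝ᵥ l' - M * ∑ w`. Each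
  -- factor `M - l' i` is positive, so `w` vanishes.
  have h3 : ∑ i, w i * (M - l' i) ≤ 0 := by
    have : ∑ i, w i * (M - l' i) = M * ∑ i, w i - w ⬝ᵥ l' := by
      rw [Finset.mul_sum, dotProduct, ← Finset.sum_sub_distrib]
      exact Finset.sum_congr rfl fun i _ => by ring
    linarith
  have hpos : ∀ i, 0 < M - l' i := fun i => by linarith [hl'K i]
  have h4 : ∀ i ∈ Finset.univ, 0 ≤ w i * (M - l' i) :=
    fun i _ => mul_nonneg (h.w_nonneg i) (hpos i).le
  have hw : w = 0 := by
    funext i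
    have := (Finset.sum_eq_zero_iff_of_nonneg h4).1 (le_antisymm h3 (Finset.sum_nonneg h4)) i
      (Finset.mem_univ i)
    exact (mul_eq_zero.1 this).resolve_right (hpos i).ne'
  refine ⟨hw, fun u' hu' hAu' => ?_⟩
  rw [hkkt, hw]
  simpa using hweak l b u' h.l_nonneg h.dual hu' hAu'

end LinearProgramming

/-! ### Extreme points and extreme rays through active constraints. -/

section Polyhedra

variable {ι : Type*} [Fintype ι]

/-- Ratio test: moving from `z ≥ 0` in a direction with a negative entry, the boundary is reached. -/
theorem exists_ratio_step {z δ : ι → ℝ} (hz : 0 ≤ z) (hzδ : ∀ i, z i = 0 → δ i = 0)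
    (hneg : ∃ i, δ i < 0) :
    ∃ t : ℝ, 0 < t ∧ 0 ≤ z + t • δ ∧ ∃ i, z i ≠ 0 ∧ (z + t • δ) i = 0 := by
  classical
  obtain ⟨i, hi, hmin⟩ := Finset.exists_min_image (Finset.univ.filter fun i => δ i < 0)
    (fun i => z i / -δ i) (by obtain ⟨i, hi⟩ := hneg; exact ⟨i, by simp [hi]⟩)
  have hi' : δ i < 0 := by simpa using hi
  have hzi : z i ≠ 0 := fun h => hi'.ne (hzδ i h)
  have hzi' : 0 < z i := lt_of_le_of_ne (hz i) hzi.symm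
  refine ⟨z i / -δ i, div_pos hzi' (by linarith), fun k => ?_, i, hzi, ?_⟩
  · simp only [Pi.zero_apply, Pi.add_apply, Pi.smul_apply, smul_eq_mul]
    have ht : 0 < z i / -δ i := div_pos hzi' (by linarith)
    rcases lt_or_ge (δ k) 0 with hk | hk
    · have := hmin k (by simpa using hk)
      rw [le_div_iff₀ (by linarith)] at this
      linarith
    · have := mul_nonneg ht.le hk
      have := hz k
      simp only [Pi.zero_apply] at this
      linarith
  · simp only [Pi.add_apply, Pi.smul_apply, smul_eq_mul]
    have := hi'.ne
    field_simp
    ring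

theorem exists_small_step {z δ : ι → ℝ} (hz : 0 ≤ z) (hzδ : ∀ i, z i = 0 → δ i = 0) :
    ∃ t : ℝ, 0 < t ∧ 0 ≤ z + t • δ := by
  by_cases h : ∃ i, δ i < 0
  · obtain ⟨t, ht, h', -⟩ := exists_ratio_step hz hzδ h
    exact ⟨t, ht, h'⟩
  · push Not at h
    exact ⟨1, one_pos, by rw [one_smul]; exact add_nonneg hz h⟩

variable {V : Type*} [AddCommGroup V] [Module ℝ V] {L : V →ₗ[ℝ] ι → ℝ} {a : ι → ℝ}

/-- An extreme point of a polyhedron is determined by its active constraints. -/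
theorem eq_of_mem_extremePoints_of_active {v w : V}
    (hv : v ∈ Set.extremePoints ℝ {v | 0 ≤ L v + a}) (hw : 0 ≤ L w + a)
    (h : ∀ i, (L v + a) i = 0 → (L w + a) i = 0) : v = w := by
  obtain ⟨hvP, hext⟩ := mem_extremePoints.1 hv
  obtain ⟨t, ht, hstep⟩ := exists_small_step (δ := L (v - w)) hvP (by
    intro i hi
    have h1 := h i hi
    simp only [Pi.add_apply] at hi h1
    rw [map_sub, Pi.sub_apply]
    linarith)
  -- `v` lies in the open segment between `v + t • (v - w)` and `w`, so extremality identifies it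
  -- with `w`.
  refine (hext (v + t • (v - w)) ?_ w hw ?_).2.symm
  · change 0 ≤ L (v + t • (v - w)) + a
    rw [map_add, map_smul, add_right_comm]
    exact hstep
  · refine ⟨1 / (1 + t), t / (1 + t), by positivity, by positivity, ?_, ?_⟩
    · field_simp
    · have h1 : (1 / (1 + t)) * t = t / (1 + t) := by ring
      have h2 : 1 / (1 + t) + t / (1 + t) = 1 := by field_simp
      rw [smul_add, smul_smul, h1, smul_sub, add_assoc, sub_add_cancel, ← add_smul, h2, one_smul]

theorem finite_extremePoints_polyhedron : (Set.extremePoints ℝ {v | 0 ≤ L v + a}).Finite := by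
  refine Set.Finite.of_finite_image (f := fun v => {i | (L v + a) i = 0}) (Set.toFinite _) ?_
  intro v hv w hw hvw
  exact eq_of_mem_extremePoints_of_active hv (extremePoints_subset hw)
    fun i hi => (Set.ext_iff.1 hvw i).1 hi

/-- A recession direction that satisfies all the active constraints of a generator of an extreme
ray with equality is a multiple of this generator. -/
theorem exists_eq_smul_of_active {v w : V} (hv : 0 ≤ L v)
    (hext : ∀ α, 0 ≤ L α → ∀ β, 0 ≤ L β → α + β = v → ∃ t : ℝ, 0 ≤ t ∧ β = t • v)
    (hw : 0 ≤ L w) (h : ∀ i, L v i = 0 → L w i = 0) : ∃ t : ℝ, 0 ≤ t ∧ w = t • v := by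
  -- For small `t`, `v - t • w` stays in the cone; then `v = (v - t • w) + t • w` is a decomposition
  -- to which extremality applies.
  obtain ⟨t, ht, hstep⟩ := exists_small_step (δ := L (-w)) hv (by
    intro i hi
    rw [map_neg, Pi.neg_apply, h i hi, neg_zero])
  obtain ⟨s, hs, hs'⟩ := hext (v + t • (-w)) (by rwa [map_add, map_smul]) (t • w)
    (by rw [map_smul]; exact smul_nonneg ht.le hw) (by simp)
  refine ⟨t⁻¹ * s, by positivity, ?_⟩
  rw [mul_smul, ← hs', smul_smul, inv_mul_cancel₀ ht.ne', one_smul]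

/-- Moving along a line inside a face reaches a point with more active constraints. -/
theorem exists_more_active (hL : Function.Injective L) (W : V →ₗ[ℝ] ℝ) {v δ : V}
    (hv : 0 ≤ L v + a) (hδ : δ ≠ 0) (hvδ : ∀ i, (L v + a) i = 0 → L δ i = 0) (hW : W δ = 0) :
    ∃ v', 0 ≤ L v' + a ∧ W v' = W v ∧
      {i | (L v' + a) i ≠ 0}.ncard < {i | (L v + a) i ≠ 0}.ncard := by
  wlog hneg : ∃ i, L δ i < 0 generalizing δ
  · refine this (δ := -δ) (neg_ne_zero.2 hδ) (fun i hi => by simp [hvδ i hi]) (by simp [hW]) ?_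
    push Not at hneg
    by_contra hcon
    push Not at hcon
    refine hδ (hL ?_)
    rw [map_zero]
    funext i
    have := hcon i
    rw [map_neg, Pi.neg_apply] at this
    exact le_antisymm (by simpa using this) (hneg i)
  obtain ⟨t, ht, hstep, i, hi, hi'⟩ := exists_ratio_step hv hvδ hneg
  have e : L (v + t • δ) + a = L v + a + t • L δ := by rw [map_add, map_smul, add_right_comm]
  refine ⟨v + t • δ, by rwa [e], by simp [hW], Set.ncard_lt_ncard ?_ (Set.toFinite _)⟩
  rw [e]
  refine ⟨fun k hk hk' => hk ?_, fun hsub => hsub (a := i) hi hi'⟩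
  rw [Pi.add_apply, hk', Pi.smul_apply, hvδ k hk', smul_zero, add_zero]

/-- A linear functional that attains its maximum over a pointed polyhedron attains it at an extreme
point. -/
theorem exists_extremePoint_eq (hL : Function.Injective L) (W : V →ₗ[ℝ] ℝ) {v : V}
    (hv : 0 ≤ L v + a) (hmax : ∀ v', 0 ≤ L v' + a → W v' ≤ W v) :
    ∃ e ∈ Set.extremePoints ℝ {v | 0 ≤ L v + a}, W e = W v := by
  -- Induction on the number of inactive constraints: a non-extreme maximizer lies inside a segment
  -- on which `W` is constant, and moving along it activates a further constraint.
  induction hn : {i | (L v + a) i ≠ 0}.ncard using Nat.strong_induction_on generalizing v with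
  | _ n ih =>
    by_cases hext : v ∈ Set.extremePoints ℝ {v | 0 ≤ L v + a}
    · exact ⟨v, hext, rfl⟩
    have hne : ∃ x₁, 0 ≤ L x₁ + a ∧ ∃ x₂, 0 ≤ L x₂ + a ∧ v ∈ openSegment ℝ x₁ x₂ ∧ x₁ ≠ x₂ := by
      by_contra hcon
      push Not at hcon
      refine hext (mem_extremePoints.2 ⟨hv, fun x₁ h₁ x₂ h₂ hx => ?_⟩)
      have := hcon x₁ h₁ x₂ h₂ hx
      subst this
      rw [openSegment_same, Set.mem_singleton_iff] at hx
      exact ⟨hx.symm, hx.symm⟩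
    obtain ⟨x₁, h₁, x₂, h₂, ⟨p, q, hp, hq, hpq, rfl⟩, hx⟩ := hne
    have hm₁ := hmax x₁ h₁
    have hm₂ := hmax x₂ h₂
    simp only [map_add, map_smul, smul_eq_mul] at hm₁ hm₂
    obtain rfl : q = 1 - p := by linarith
    have hWeq : W x₁ = W x₂ := by
      refine le_antisymm ?_ ?_
      · exact le_of_mul_le_mul_left (by linarith) hq
      · exact le_of_mul_le_mul_left (by linarith) hp
    obtain ⟨v', hv', hWv', hlt⟩ := exists_more_active hL W hv (sub_ne_zero.2 hx) (by
      intro i hi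
      have g₁ := h₁ i
      have g₂ := h₂ i
      simp only [Pi.zero_apply, Pi.add_apply, map_add, map_smul, Pi.smul_apply, smul_eq_mul]
        at hi g₁ g₂
      have k₁ := mul_nonneg hp.le g₁
      have k₂ := mul_nonneg hq.le g₂
      have e₁ : p * (L x₁ i + a i) = 0 := by linarith
      have e₂ : (1 - p) * (L x₂ i + a i) = 0 := by linarith
      have f₁ := (mul_eq_zero.1 e₁).resolve_left hp.ne'
      have f₂ := (mul_eq_zero.1 e₂).resolve_left hq.ne'
      rw [map_sub, Pi.sub_apply]
      linarith) (by rw [map_sub, hWeq, sub_self])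
    obtain ⟨e, he, hWe⟩ := ih _ (hn ▸ hlt) hv' (by rwa [hWv']) rfl
    exact ⟨e, he, hWe.trans hWv'⟩

/-- A linear functional that is nonpositive on the extreme rays of a pointed polyhedral cone is
nonpositive on the cone. -/
theorem nonpos_of_extremeRays (hL : Function.Injective L) (W : V →ₗ[ℝ] ℝ)
    (hray : ∀ v, 0 ≤ L v → v ≠ 0 → (∀ α, 0 ≤ L α → ∀ β, 0 ≤ L β → α + β = v →
      (∃ s : ℝ, 0 ≤ s ∧ α = s • v) ∧ ∃ t : ℝ, 0 ≤ t ∧ β = t • v) → W v ≤ 0)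
    {v : V} (hv : 0 ≤ L v) : W v ≤ 0 := by
  induction hn : {i | (L v + 0) i ≠ 0}.ncard using Nat.strong_induction_on generalizing v with
  | _ n ih =>
    by_contra hpos
    push Not at hpos
    have hv0 : v ≠ 0 := by rintro rfl; simp at hpos
    have hmult : ∀ α, 0 ≤ L α → 0 ≤ L (v - α) → ∃ s : ℝ, 0 ≤ s ∧ α = s • v := by
      intro α hα hβ
      have hle : ∀ i, L α i ≤ L v i := fun i => by
        have := hβ i
        rw [map_sub, Pi.sub_apply] at this
        simpa using this
      -- This direction lies in the kernel of `W`. If it were nonzero, moving along it would give a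
      -- cone point with the same positive `W` and fewer inactive constraints, against the induction
      -- hypothesis. Hence `v` is extreme.
      by_cases hδ : α - (W α / W v) • v = 0
      · have he := sub_eq_zero.1 hδ
        refine ⟨_, ?_, he⟩
        by_contra hs
        push Not at hs
        refine hv0 (hL ?_)
        rw [map_zero]
        funext i
        have h1 := hα i
        have h2 := hv i
        rw [he, map_smul, Pi.smul_apply, smul_eq_mul] at h1
        simp only [Pi.zero_apply] at h1 h2 ⊢
        by_contra hne
        have := mul_neg_of_neg_of_pos hs (lt_of_le_of_ne h2 (Ne.symm hne))
        linarith
      · obtain ⟨v', hv', hWv', hlt⟩ := exists_more_active (a := 0) (v := v) hL W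
          (by rwa [add_zero]) hδ (by
            intro i hi
            rw [add_zero] at hi
            have h1 := hα i
            have h2 := hle i
            rw [hi] at h2
            have h3 : L α i = 0 := le_antisymm h2 h1
            simp [hi, h3]) (by simp [hpos.ne'])
        rw [add_zero] at hv'
        have := ih _ (hn ▸ hlt) hv' rfl
        linarith
    refine absurd (hray v hv hv0 fun α hα β hβ hαβ => ⟨hmult α hα ?_, hmult β hβ ?_⟩)
      (not_le.2 hpos)
    · rwa [← hαβ, add_sub_cancel_left]
    · rwa [← hαβ, add_sub_cancel_right]

end Polyhedra

/-! ### Relaxation and equivalence of programs. -/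

namespace Program

variable {X : Type} {P Q : Program X}

theorem IsRelaxationOf.optimalValue_le (h : P.IsRelaxationOf Q) :
    P.optimalValue ≤ Q.optimalValue := by
  refine le_iInf₂ fun t ht => ?_
  obtain ⟨s, hs, -, hle⟩ := h t ht
  exact (iInf₂_le s hs).trans hle

theorem IsRelaxationOf.isOptimalFirstStage (h : P.IsRelaxationOf Q)
    (hval : P.optimalValue = Q.optimalValue) {x : X} (hx : Q.IsOptimalFirstStage x) :
    P.IsOptimalFirstStage x := by
  obtain ⟨t, ⟨ht, hopt⟩, rfl⟩ := hx
  obtain ⟨s, hs, hfs, hle⟩ := h t ht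
  exact ⟨s, ⟨hs, le_antisymm (hle.trans (hopt.trans hval.symm).le) (iInf₂_le s hs)⟩, hfs⟩

theorem Equivalent.of_isRelaxationOf (h : P.IsRelaxationOf Q) (h' : Q.IsRelaxationOf P) :
    P.Equivalent Q :=
  have hval := le_antisymm h.optimalValue_le h'.optimalValue_le
  ⟨hval, fun _ => ⟨h'.isOptimalFirstStage hval.symm, h.isOptimalFirstStage hval⟩⟩

theorem Equivalent.trans {S : Program X} (h : P.Equivalent Q) (h' : Q.Equivalent S) :
    P.Equivalent S :=
  ⟨h.1.trans h'.1, fun x => (h.2 x).trans (h'.2 x)⟩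

end Program

theorem penalty_zero {q : ℕ} : penalty (0 : Fin q → ℝ) = 0 := if_pos rfl

theorem penalty_of_ne_zero {q : ℕ} {w : Fin q → ℝ} (h : w ≠ 0) : penalty w = ⊤ := if_neg h

/-! ### The dual of the recourse problem and the inner linear programs. -/

namespace TwoStageData

variable {nx mx p nu mu q ny r : ℕ} (D : TwoStageData nx mx p nu mu q ny r)

/-- The slack variables of the homogeneous dual constraints `γ ≥ 0`, `B₂ᵀ γ ≤ 0`. -/
def dualSlack : (Fin r → ℝ) →ₗ[ℝ] (Fin r ⊕ Fin ny → ℝ) where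
  toFun γ := Sum.elim γ (-(D.B₂ᵀ *ᵥ γ))
  map_add' γ δ := by
    ext (i | j) <;> simp [Matrix.mulVec_add, add_comm]
  map_smul' t γ := by
    ext (i | j) <;> simp [Matrix.mulVec_smul]

theorem dualSlack_injective : Function.Injective D.dualSlack := fun _ _ h =>
  funext fun i => congrFun h (Sum.inl i)

theorem nonneg_dualSlack_iff (γ : Fin r → ℝ) : 0 ≤ D.dualSlack γ ↔ γ ∈ D.recessionCone := by
  change (0 : Fin r ⊕ Fin ny → ℝ) ≤ Sum.elim γ (-(D.B₂ᵀ *ᵥ γ)) ↔ D.B₂ᵀ *ᵥ γ ≤ 0 ∧ 0 ≤ γ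
  rw [← Sum.elim_zero_zero, Sum.elim_le_elim_iff, and_comm, neg_nonneg]

theorem nonneg_dualSlack_add_iff (π : Fin r → ℝ) :
    0 ≤ D.dualSlack π + Sum.elim (0 : Fin r → ℝ) D.c₂ ↔ π ∈ D.dualPolyhedron := by
  change (0 : Fin r ⊕ Fin ny → ℝ) ≤ Sum.elim π (-(D.B₂ᵀ *ᵥ π)) + Sum.elim (0 : Fin r → ℝ) D.c₂ ↔
    D.B₂ᵀ *ᵥ π ≤ D.c₂ ∧ 0 ≤ π
  rw [← Sum.elim_zero_zero, ← Sum.elim_add_add, Sum.elim_le_elim_iff, and_comm, add_zero,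
    neg_add_eq_sub, sub_nonneg]

theorem dualPolyhedron_eq :
    D.dualPolyhedron = {π | 0 ≤ D.dualSlack π + Sum.elim (0 : Fin r → ℝ) D.c₂} :=
  Set.ext fun π => (D.nonneg_dualSlack_add_iff π).symm

theorem finite_extremePts : D.extremePts.Finite := by
  rw [extremePts, dualPolyhedron_eq]
  exact finite_extremePoints_polyhedron

/-- Two listed generators with the same active constraints are positive multiples of each other, so
they span one ray and coincide. -/
theorem IsExtremeRaySystem.finite {D : TwoStageData nx mx p nu mu q ny r} {R : Set (Fin r → ℝ)}
    (hR : D.IsExtremeRaySystem R) : R.Finite := by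
  refine Set.Finite.of_finite_image (f := fun v => {i | D.dualSlack v i = 0}) (Set.toFinite _) ?_
  intro v hv w hw hvw
  have hvr := hR.1 v hv
  have hwr := hR.1 w hw
  obtain ⟨t, ht, rfl⟩ := exists_eq_smul_of_active ((D.nonneg_dualSlack_iff v).2 hvr.1)
    (fun α hα β hβ hαβ => (hvr.2.2 α ((D.nonneg_dualSlack_iff α).1 hα) β
      ((D.nonneg_dualSlack_iff β).1 hβ) hαβ).2)
    ((D.nonneg_dualSlack_iff w).2 hwr.1) fun i hi => (Set.ext_iff.1 hvw i).1 hi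
  have ht' : 0 < t := lt_of_le_of_ne ht (by
    rintro rfl
    exact hwr.2.1 (zero_smul _ _))
  exact (hR.2 _ hwr).unique ⟨hv, t, ht', rfl⟩ ⟨hw, 1, one_pos, (one_smul _ _).symm⟩

theorem extremePts_nonneg {π : Fin r → ℝ} (h : π ∈ D.extremePts) : 0 ≤ π :=
  (extremePoints_subset h : π ∈ D.dualPolyhedron).2

/-- The right-hand side of the uncertainty system in the continuous scenario variables. -/
def uncertaintyRhs (x : FirstStage nx mx) (ud : Fin mu → ℕ) : Fin q → ℝ :=
  D.h + D.G *ᵥ x.vec - D.Fd x *ᵥ natVec ud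

/-- The right-hand side of the recourse problem. -/
def recourseRhs (x : FirstStage nx mx) (u : (Fin nu → ℝ) × (Fin mu → ℕ)) : Fin r → ℝ :=
  D.d - D.B₁ *ᵥ x.vec - D.Ec *ᵥ u.1 - D.Ed *ᵥ natVec u.2

theorem mem_U_iff (x : FirstStage nx mx) (u : (Fin nu → ℝ) × (Fin mu → ℕ)) :
    u ∈ D.U x ↔ 0 ≤ u.1 ∧ u.2 ∈ D.Ud ∧ D.Fc x *ᵥ u.1 ≤ D.uncertaintyRhs x u.2 := by
  rw [uncertaintyRhs, le_sub_iff_add_le]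
  rfl

theorem mem_KKT_iff (M : ℝ) (x : FirstStage nx mx) (ud : Fin mu → ℕ) (β : Fin r → ℝ)
    (uc : Fin nu → ℝ) (ut lam : Fin q → ℝ) :
    (uc, ut, lam) ∈ D.KKT M x ud β ↔
      PenaltyKKT (D.Fc x) (D.uncertaintyRhs x ud) (-(D.Ecᵀ *ᵥ β)) M uc ut lam := by
  constructor
  · rintro ⟨h1, h2, h3, h4, h5, h6, h7, h8, h9⟩
    exact ⟨h1, h2, h3, h4, fun j => by simpa using h5 j, h6, h7, h8, h9⟩
  · rintro ⟨h1, h2, h3, h4, h5, h6, h7, h8, h9⟩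
    exact ⟨h1, h2, h3, h4, fun j => by simpa using h5 j, h6, h7, h8, h9⟩

variable {D}

/-- A nonempty bounded uncertainty set has no nonzero continuous recession direction. -/
theorem eq_zero_of_isBounded_U {x : FirstStage nx mx} (hne : (D.U x).Nonempty)
    (hbdd : Bornology.IsBounded (D.U x)) {v : Fin nu → ℝ} (hv : 0 ≤ v) (hFv : D.Fc x *ᵥ v ≤ 0) :
    v = 0 := by
  obtain ⟨u, hu⟩ := hne
  obtain ⟨C, hC⟩ := hbdd.image_fst.exists_norm_le
  have hmem : ∀ k : ℕ, u.1 + (k : ℝ) • v ∈ Prod.fst '' D.U x := by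
    intro k
    refine ⟨(u.1 + (k : ℝ) • v, u.2), ?_, rfl⟩
    rw [mem_U_iff] at hu ⊢
    refine ⟨add_nonneg hu.1 (smul_nonneg k.cast_nonneg hv), hu.2.1, ?_⟩
    rw [Matrix.mulVec_add, Matrix.mulVec_smul]
    exact add_le_of_le_of_nonpos hu.2.2 (smul_nonpos_of_nonneg_of_nonpos k.cast_nonneg hFv)
  by_contra hv0
  obtain ⟨k, hk⟩ := exists_nat_gt ((C + ‖u.1‖) / ‖v‖)
  rw [div_lt_iff₀ (norm_pos_iff.2 hv0)] at hk
  have h1 := hC _ (hmem k)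
  have h2 : ‖(k : ℝ) • v‖ ≤ ‖u.1 + (k : ℝ) • v‖ + ‖u.1‖ := by
    simpa using norm_sub_le (u.1 + (k : ℝ) • v) u.1
  rw [norm_smul, Real.norm_natCast] at h2
  linarith

/-- The Karush-Kuhn-Tucker system is solvable once the penalty coefficient reaches a dual bound. -/
theorem KKT_nonempty {x : FirstStage nx mx} (hne : (D.U x).Nonempty)
    (hbdd : Bornology.IsBounded (D.U x)) {β : Fin r → ℝ} {K M : ℝ}
    (hK : HasDualBound (D.Fc x) (-(D.Ecᵀ *ᵥ β)) K) (hKM : K ≤ M) (ud : Fin mu → ℕ) :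
    ∃ uc ut lam, (uc, ut, lam) ∈ D.KKT M x ud β := by
  -- Dual feasibility by Farkas: a certificate against it would be tested on recession directions of
  -- the fiber, and only zero remains.
  obtain ⟨l, hl, hl'⟩ := farkas_matrix (D.Fc x)ᵀ (-(D.Ecᵀ *ᵥ β)) fun v hv hFv => by
    rw [eq_zero_of_isBounded_U hne hbdd hv (by rwa [Matrix.transpose_transpose] at hFv),
      dotProduct_zero]
  obtain ⟨l₀, h1, h2, h3, -⟩ := hK l hl hl'
  obtain ⟨uc, ut, lam, h⟩ := PenaltyKKT.exists_of_dual_feasible (D.Fc x) (D.uncertaintyRhs x ud)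
    (-(D.Ecᵀ *ᵥ β)) M h1 h2 fun i => (h3 i).trans hKM
  exact ⟨uc, ut, lam, (D.mem_KKT_iff M x ud β uc ut lam).2 h⟩

/-- At a discrete scenario with a nonempty fiber, the Karush-Kuhn-Tucker points have no violation
and minimize `β E_c u_c` over the fiber. -/
theorem KKT_exact {x : FirstStage nx mx} {β : Fin r → ℝ} {K M : ℝ}
    (hK : HasDualBound (D.Fc x) (-(D.Ecᵀ *ᵥ β)) K) (hKM : K < M)
    {u : (Fin nu → ℝ) × (Fin mu → ℕ)} (hu : u ∈ D.U x) {uc : Fin nu → ℝ} {ut lam : Fin q → ℝ}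
    (h : (uc, ut, lam) ∈ D.KKT M x u.2 β) :
    ut = 0 ∧ β ⬝ᵥ D.Ec *ᵥ uc ≤ β ⬝ᵥ D.Ec *ᵥ u.1 := by
  rw [mem_U_iff] at hu
  obtain ⟨h0, hopt⟩ := ((D.mem_KKT_iff M x u.2 β uc ut lam).1 h).exact hK hKM hu.1 hu.2.2
  have := hopt u.1 hu.1 hu.2.2
  rw [neg_dotProduct, neg_dotProduct, neg_le_neg_iff] at this
  exact ⟨h0, by rwa [dotProduct_mulVec_eq, dotProduct_mulVec_eq]⟩

/-- A recourse decision for the worst continuous scenario bounds the value of the dual solution `β`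
at every scenario. -/
theorem recourseRhs_dotProduct_le {x : FirstStage nx mx} {u : (Fin nu → ℝ) × (Fin mu → ℕ)}
    {β : Fin r → ℝ} (hβ : 0 ≤ β) {y : Fin ny → ℝ} {uc : Fin nu → ℝ}
    (hrec : D.PenalizedRecourse x u.2 y uc 0) (huc : β ⬝ᵥ D.Ec *ᵥ uc ≤ β ⬝ᵥ D.Ec *ᵥ u.1) :
    D.recourseRhs x u ⬝ᵥ β ≤ (D.B₂ᵀ *ᵥ β) ⬝ᵥ y := by
  have h1 : D.d - D.B₁ *ᵥ x.vec - D.Ed *ᵥ natVec u.2 ≤ D.B₂ *ᵥ y + D.Ec *ᵥ uc := by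
    intro i
    have := hrec i
    rw [penalty_zero, add_zero] at this
    exact EReal.coe_le_coe_iff.1 this
  have h2 := dotProduct_le_of_le hβ h1
  rw [dotProduct_add, dotProduct_mulVec_eq] at h2
  have h3 : D.recourseRhs x u ⬝ᵥ β =
      β ⬝ᵥ (D.d - D.B₁ *ᵥ x.vec - D.Ed *ᵥ natVec u.2) - β ⬝ᵥ D.Ec *ᵥ u.1 := by
    rw [dotProduct_comm, ← dotProduct_sub, recourseRhs, sub_right_comm]
  linarith

/-- The recourse problem is feasible when its right-hand side is nonpositive on extreme rays. -/
theorem Y_nonempty {R : Set (Fin r → ℝ)} (hR : D.IsExtremeRaySystem R) {x : FirstStage nx mx}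
    {u : (Fin nu → ℝ) × (Fin mu → ℕ)} (h : ∀ γ ∈ R, D.recourseRhs x u ⬝ᵥ γ ≤ 0) :
    (D.Y x u).Nonempty := by
  obtain ⟨y, hy, hy'⟩ := farkas_matrix D.B₂ (D.recourseRhs x u) (by
    intro γ hγ hγ'
    refine nonpos_of_extremeRays D.dualSlack_injective
      (dotProductBilin ℝ ℝ (D.recourseRhs x u)) ?_ ((D.nonneg_dualSlack_iff γ).2 ⟨hγ', hγ⟩)
    intro v hv hv0 hext
    obtain ⟨γ', ⟨hγ', t, ht, rfl⟩, -⟩ := hR.2 v ⟨(D.nonneg_dualSlack_iff v).1 hv, hv0,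
      fun α hα β hβ hαβ => hext α ((D.nonneg_dualSlack_iff α).2 hα) β
        ((D.nonneg_dualSlack_iff β).2 hβ) hαβ⟩
    rw [map_smul]
    exact smul_nonpos_of_nonneg_of_nonpos ht.le (h γ' hγ'))
  exact ⟨y, hy, hy'⟩

/-- A feasible bounded recourse problem has an optimal solution, with an optimal dual solution at an
extreme point. -/
theorem exists_optimal_recourse {x : FirstStage nx mx} {u : (Fin nu → ℝ) × (Fin mu → ℕ)} {w : ℝ}
    (hne : (D.Y x u).Nonempty) (hw : ∀ y ∈ D.Y x u, w ≤ D.c₂ ⬝ᵥ y) :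
    ∃ y ∈ D.Y x u, (∀ y' ∈ D.Y x u, D.c₂ ⬝ᵥ y ≤ D.c₂ ⬝ᵥ y') ∧
      ∃ π ∈ D.extremePts, D.c₂ ⬝ᵥ y = D.recourseRhs x u ⬝ᵥ π := by
  obtain ⟨y₀, hy₀, hBy₀⟩ := hne
  obtain ⟨y, π, hy, hBy, hπ, hBπ, heq⟩ := exists_optimal_pair D.B₂ (D.recourseRhs x u) D.c₂ w
    hy₀ hBy₀ fun y hy hy' => hw y ⟨hy, hy'⟩
  obtain ⟨e, he, he'⟩ := exists_extremePoint_eq D.dualSlack_injective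
    (dotProductBilin ℝ ℝ (D.recourseRhs x u))
    ((D.nonneg_dualSlack_add_iff π).2 ⟨hBπ, hπ⟩) (by
      intro π' hπ'
      rw [nonneg_dualSlack_add_iff] at hπ'
      exact (weak_duality hy hBy hπ'.2 hπ'.1).trans heq.le)
  rw [← dualPolyhedron_eq] at he
  exact ⟨y, ⟨hy, hBy⟩, fun y' hy' => heq.trans_le (weak_duality hy'.1 hy'.2 hπ hBπ), e, he,
    heq.trans he'.symm⟩

/-! ### The threshold and the two relaxations. -/

section Equivalence

variable {R : Set (Fin r → ℝ)} {μ : Matrix (Fin q) (Fin nu) ℝ → ℝ} {M : FirstStage nx mx → ℝ}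

variable (D R) in
/-- One dual bound below `μ F` for all the extreme points and all the listed extreme rays. -/
theorem exists_threshold (hR : D.IsExtremeRaySystem R) :
    ∃ μ : Matrix (Fin q) (Fin nu) ℝ → ℝ, ∀ F, ∀ β ∈ D.extremePts ∪ R,
      HasDualBound F (-(D.Ecᵀ *ᵥ β)) (μ F - 1) := by
  have h : ∀ F : Matrix (Fin q) (Fin nu) ℝ, ∃ K, ∀ β ∈ D.extremePts ∪ R,
      HasDualBound F (-(D.Ecᵀ *ᵥ β)) K := fun F =>
    (D.finite_extremePts.union hR.finite).exists_forall_of_mono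
      (P := fun β K => HasDualBound F (-(D.Ecᵀ *ᵥ β)) K)
      (fun _ _ _ hKK h => h.mono hKK) fun _ _ => exists_hasDualBound _ _
  choose K hK using h
  -- The added `1` gives the strict inequality `K < M` that exact penalization requires.
  exact ⟨fun F => K F + 1, fun F β hβ => by simpa using hK F β hβ⟩

theorem twoStageRO_isRelaxationOf_singleLevel
    (hA3 : ∃ w : ℝ, ∀ x ∈ D.X, ∀ u ∈ D.U x, ∀ y ∈ D.Y x u, w ≤ D.c₁ ⬝ᵥ x.vec + D.c₂ ⬝ᵥ y)
    (hR : D.IsExtremeRaySystem R)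
    (hμ : ∀ F, ∀ β ∈ D.extremePts ∪ R, HasDualBound F (-(D.Ecᵀ *ᵥ β)) (μ F - 1))
    (hM : ∀ x ∈ D.X, μ (D.Fc x) ≤ M x) :
    D.twoStageRO.IsRelaxationOf (D.singleLevel M ((D.Ud : Set (Fin mu → ℕ)) ×ˢ D.extremePts)
      ((D.Ud : Set (Fin mu → ℕ)) ×ˢ R)) := by
  rintro s ⟨hx, ho, hf⟩
  have hKM : μ (D.Fc s.x) - 1 < M s.x := by linarith [hM _ hx]
  have hY : ∀ u ∈ D.U s.x, (D.Y s.x u).Nonempty := by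
    refine fun u hu => Y_nonempty hR fun γ hγ => ?_
    obtain ⟨hrec, hy, hkkt⟩ := hf ⟨(u.2, γ), hu.2.1, hγ⟩
    obtain ⟨h0, hle⟩ := KKT_exact (hμ _ γ (Or.inr hγ)) hKM hu hkkt
    rw [h0] at hrec
    have hcone := (hR.1 γ hγ).1
    refine (recourseRhs_dotProduct_le hcone.2 hrec hle).trans ?_
    rw [dotProduct_comm]
    exact (dotProduct_le_of_le hy hcone.1).trans (dotProduct_zero _).le
  refine ⟨s.x, ⟨hx, hY⟩, rfl, ?_⟩
  change ((D.c₁ ⬝ᵥ s.x.vec : ℝ) : EReal) +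
    (⨆ u ∈ D.U s.x, ⨅ y ∈ D.Y s.x u, ((D.c₂ ⬝ᵥ y : ℝ) : EReal)) ≤
      ((D.c₁ ⬝ᵥ s.x.vec + s.η : ℝ) : EReal)
  rw [EReal.coe_add]
  refine add_le_add le_rfl (iSup₂_le fun u hu => ?_)
  obtain ⟨w, hw⟩ := hA3
  -- The extreme point `π` certifying the recourse value at `u` selects the block whose `η`
  -- constraint is used.
  obtain ⟨y, hy, -, π, hπ, heq⟩ := exists_optimal_recourse (w := w - D.c₁ ⬝ᵥ s.x.vec) (hY u hu)
    fun y hy => by linarith [hw s.x hx u hu y hy]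
  refine iInf₂_le_of_le y hy (EReal.coe_le_coe_iff.2 ?_)
  obtain ⟨hη, hy', hrec, hkkt⟩ := ho ⟨(u.2, π), hu.2.1, hπ⟩
  obtain ⟨h0, hle⟩ := KKT_exact (hμ _ π (Or.inl hπ)) hKM hu hkkt
  rw [h0] at hrec hη
  rw [penalty_zero, sub_zero, EReal.coe_le_coe_iff] at hη
  refine heq.le.trans ((recourseRhs_dotProduct_le (D.extremePts_nonneg hπ) hrec hle).trans ?_)
  refine le_trans ?_ hη
  rw [dotProduct_comm, dotProduct_comm D.c₂]
  exact dotProduct_le_of_le hy' (extremePoints_subset hπ : π ∈ D.dualPolyhedron).1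

/-- For a feasible first-stage decision, every block of the single-level program is solvable at a
cost that does not exceed the worst-case recourse cost. -/
theorem exists_block
    (hA3 : ∃ w : ℝ, ∀ x ∈ D.X, ∀ u ∈ D.U x, ∀ y ∈ D.Y x u, w ≤ D.c₁ ⬝ᵥ x.vec + D.c₂ ⬝ᵥ y)
    {x : FirstStage nx mx} (hx : x ∈ D.X) (hne : (D.U x).Nonempty)
    (hbdd : Bornology.IsBounded (D.U x)) (hfeas : ∀ u ∈ D.U x, (D.Y x u).Nonempty)
    {β : Fin r → ℝ} {K M : ℝ} (hK : HasDualBound (D.Fc x) (-(D.Ecᵀ *ᵥ β)) K) (hKM : K ≤ M)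
    {ud : Fin mu → ℕ} (hud : ud ∈ D.Ud) :
    ∃ y uc ut lam, ((D.c₂ ⬝ᵥ y : ℝ) : EReal) - penalty ut ≤
        (⨆ u ∈ D.U x, ⨅ y ∈ D.Y x u, ((D.c₂ ⬝ᵥ y : ℝ) : EReal)) ∧
      0 ≤ y ∧ D.PenalizedRecourse x ud y uc ut ∧ (uc, ut, lam) ∈ D.KKT M x ud β := by
  obtain ⟨uc, ut, lam, hkkt⟩ := KKT_nonempty hne hbdd hK hKM ud
  by_cases h0 : ut = 0
  · subst h0
    have hkkt' := (D.mem_KKT_iff M x ud β uc 0 lam).1 hkkt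
    have hu : (uc, ud) ∈ D.U x :=
      (D.mem_U_iff x (uc, ud)).2 ⟨hkkt'.u_nonneg, hud, by simpa using hkkt'.primal⟩
    obtain ⟨w, hw⟩ := hA3
    obtain ⟨y, hy, hmin, -⟩ := exists_optimal_recourse (w := w - D.c₁ ⬝ᵥ x.vec) (hfeas _ hu)
      fun y hy => by linarith [hw x hx _ hu y hy]
    refine ⟨y, uc, 0, lam, ?_, hy.1, fun i => ?_, hkkt⟩
    · rw [penalty_zero, sub_zero]
      exact le_iSup₂_of_le (uc, ud) hu
        (le_iInf₂ fun y' hy' => EReal.coe_le_coe_iff.2 (hmin y' hy'))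
    · rw [penalty_zero, add_zero, EReal.coe_le_coe_iff]
      have := hy.2 i
      simp only [Pi.sub_apply, Pi.add_apply] at this ⊢
      linarith
  -- Here the cost side is `⊥` and the recourse side `⊤`, so any nonnegative `y` works.
  · refine ⟨0, uc, ut, lam, ?_, le_rfl, fun i => ?_, hkkt⟩
    · rw [penalty_of_ne_zero h0, EReal.sub_top]
      exact bot_le
    · rw [penalty_of_ne_zero h0, EReal.coe_add_top]
      exact le_top

theorem singleLevel_isRelaxationOf_twoStageRO
    (hA1 : ∀ x ∈ D.X, (D.U x).Nonempty) (hA2 : ∀ x ∈ D.X, Bornology.IsBounded (D.U x))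
    (hA3 : ∃ w : ℝ, ∀ x ∈ D.X, ∀ u ∈ D.U x, ∀ y ∈ D.Y x u, w ≤ D.c₁ ⬝ᵥ x.vec + D.c₂ ⬝ᵥ y)
    (hμ : ∀ F, ∀ β ∈ D.extremePts ∪ R, HasDualBound F (-(D.Ecᵀ *ᵥ β)) (μ F - 1))
    (hM : ∀ x ∈ D.X, μ (D.Fc x) ≤ M x) {So Sf : Set ((Fin mu → ℕ) × (Fin r → ℝ))}
    (hSo : So ⊆ (D.Ud : Set (Fin mu → ℕ)) ×ˢ D.extremePts)
    (hSf : Sf ⊆ (D.Ud : Set (Fin mu → ℕ)) ×ˢ R) :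
    (D.singleLevel M So Sf).IsRelaxationOf D.twoStageRO := by
  rintro x ⟨hx, hfeas⟩
  have hKM : μ (D.Fc x) - 1 ≤ M x := by linarith [hM _ hx]
  choose y uc ut lam hcost hy hrec hkkt using fun k : So =>
    exists_block hA3 hx (hA1 x hx) (hA2 x hx) hfeas (hμ (D.Fc x) k.1.2 (Or.inl (hSo k.2).2)) hKM
      (hSo k.2).1
  choose yf vc vt zeta _ hyf hrecf hkktf using fun k : Sf =>
    exists_block hA3 hx (hA1 x hx) (hA2 x hx) hfeas (hμ (D.Fc x) k.1.2 (Or.inr (hSf k.2).2)) hKM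
      (hSf k.2).1
  obtain ⟨η, hη, hηle⟩ : ∃ η : ℝ,
      (∀ k, ((D.c₂ ⬝ᵥ y k : ℝ) : EReal) - penalty (ut k) ≤ (η : EReal)) ∧
      (η : EReal) ≤ ⨆ u ∈ D.U x, ⨅ y ∈ D.Y x u, ((D.c₂ ⬝ᵥ y : ℝ) : EReal) := by
    have hbot : (⨆ u ∈ D.U x, ⨅ y ∈ D.Y x u, ((D.c₂ ⬝ᵥ y : ℝ) : EReal)) ≠ ⊥ := by
      obtain ⟨u, hu⟩ := hA1 x hx
      obtain ⟨w, hw⟩ := hA3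
      refine ne_bot_of_le_ne_bot (EReal.coe_ne_bot (w - D.c₁ ⬝ᵥ x.vec))
        (le_iSup₂_of_le u hu (le_iInf₂ fun y hy => EReal.coe_le_coe_iff.2 ?_))
      linarith [hw x hx u hu y hy]
    generalize (⨆ u ∈ D.U x, ⨅ y ∈ D.Y x u, ((D.c₂ ⬝ᵥ y : ℝ) : EReal)) = v at hcost hbot ⊢
    induction v with
    | bot => exact absurd rfl hbot
    | coe v => exact ⟨v, hcost, le_rfl⟩
    -- Finiteness of the worst case need not be shown: any real bound on the finitely many block
    -- costs serves as `η`.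
    | top =>
      have : Finite So := ((D.Ud.finite_toSet.prod D.finite_extremePts).subset hSo).to_subtype
      obtain ⟨η, hη⟩ := (Set.finite_range fun k => D.c₂ ⬝ᵥ y k).bddAbove
      refine ⟨η, fun k => ?_, le_top⟩
      have h1 : ((D.c₂ ⬝ᵥ y k : ℝ) : EReal) ≤ (η : EReal) :=
        EReal.coe_le_coe_iff.2 (hη (Set.mem_range_self k))
      by_cases h0 : ut k = 0
      · rwa [h0, penalty_zero, sub_zero]
      · rw [penalty_of_ne_zero h0, EReal.sub_top]
        exact bot_le
  refine ⟨⟨x, η, y, uc, ut, lam, yf, vc, vt, zeta⟩,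
    ⟨hx, fun k => ⟨hη k, hy k, hrec k, hkkt k⟩, fun k => ⟨hrecf k, hyf k, hkktf k⟩⟩, rfl, ?_⟩
  change ((D.c₁ ⬝ᵥ x.vec + η : ℝ) : EReal) ≤ ((D.c₁ ⬝ᵥ x.vec : ℝ) : EReal) +
    ⨆ u ∈ D.U x, ⨅ y ∈ D.Y x u, ((D.c₂ ⬝ᵥ y : ℝ) : EReal)
  rw [EReal.coe_add]
  exact add_le_add le_rfl hηle

end Equivalence

end TwoStageData

theorem mainTheorem2 {nx mx p nu mu q ny r : ℕ}
    (D : TwoStageData nx mx p nu mu q ny r)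
    (hA1 : ∀ x ∈ D.X, (D.U x).Nonempty)
    (hA2 : ∀ x ∈ D.X, Bornology.IsBounded (D.U x))
    (hA3 : BddBelow {w : ℝ | ∃ x ∈ D.X, ∃ u ∈ D.U x, ∃ y ∈ D.Y x u,
      w = D.c₁ ⬝ᵥ x.vec + D.c₂ ⬝ᵥ y})
    (R : Set (Fin r → ℝ)) (hR : D.IsExtremeRaySystem R) :
    ∃ μ : Matrix (Fin q) (Fin nu) ℝ → ℝ,
      ∀ M : FirstStage nx mx → ℝ, (∀ x ∈ D.X, μ (D.Fc x) ≤ M x) →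
        D.twoStageRO.Equivalent
            (D.singleLevel M ((D.Ud : Set (Fin mu → ℕ)) ×ˢ D.extremePts)
              ((D.Ud : Set (Fin mu → ℕ)) ×ˢ R)) ∧
        (∀ Q : Program (FirstStage nx mx), Q.Equivalent D.twoStageRO →
          Q.Equivalent
            (D.singleLevel M ((D.Ud : Set (Fin mu → ℕ)) ×ˢ D.extremePts)
              ((D.Ud : Set (Fin mu → ℕ)) ×ˢ R))) ∧
        ∀ So ⊆ (D.Ud : Set (Fin mu → ℕ)) ×ˢ D.extremePts,
          ∀ Sf ⊆ (D.Ud : Set (Fin mu → ℕ)) ×ˢ R,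
            (D.singleLevel M So Sf).IsRelaxationOf D.twoStageRO ∧
            (D.singleLevel M So Sf).optimalValue ≤ D.twoStageRO.optimalValue := by
  have hA3' : ∃ w : ℝ, ∀ x ∈ D.X, ∀ u ∈ D.U x, ∀ y ∈ D.Y x u,
      w ≤ D.c₁ ⬝ᵥ x.vec + D.c₂ ⬝ᵥ y := by
    obtain ⟨w, hw⟩ := hA3
    exact ⟨w, fun x hx u hu y hy => hw ⟨x, hx, u, hu, y, hy, rfl⟩⟩
  obtain ⟨μ, hμ⟩ := D.exists_threshold R hR
  refine ⟨μ, fun M hM => ?_⟩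
  have hrelax := fun (So Sf : Set ((Fin mu → ℕ) × (Fin r → ℝ)))
      (hSo : So ⊆ (D.Ud : Set (Fin mu → ℕ)) ×ˢ D.extremePts)
      (hSf : Sf ⊆ (D.Ud : Set (Fin mu → ℕ)) ×ˢ R) =>
    TwoStageData.singleLevel_isRelaxationOf_twoStageRO hA1 hA2 hA3' hμ hM hSo hSf
  have hequiv := Program.Equivalent.of_isRelaxationOf
    (TwoStageData.twoStageRO_isRelaxationOf_singleLevel hA3' hR hμ hM)
    (hrelax _ _ subset_rfl subset_rfl)
  exact ⟨hequiv, fun Q hQ => hQ.trans hequiv, fun So hSo Sf hSf =>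
    ⟨hrelax So Sf hSo hSf, (hrelax So Sf hSo hSf).optimalValue_le⟩⟩
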